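/- **Setup.** Let $\mathrm B_n$ be the Artin braid group on $n$ strands with the standard generators $\sigma_1,\dots,\sigma_{n-1}$, $\rho:\mathrm B_n\to S_n$ the standard homomorphism ($g\cdot h$ is the braid $h$ followed by the braid $g$), and $\mathrm{PB}_n=\ker\rho$. Put $x_{i,i+1}=\sigma_i^2$ and $x_{13}=\sigma_2\sigma_1^2\sigma_2^{-1}$. Let $\mathrm F_2=\langle x_{12},x_{23}\rangle\le \mathrm{PB}_3$. Let $\mathsf{NFI}_{\mathrm{PB}_4}(\mathrm B_4)$ be the poset (under inclusion) of the normal subgroups of finite index in $\mathrm B_4$ that are contained in $\mathrm{PB}_4$. Let $\mathsf{PaB}$ be the operad of parenthesized braids. The objects of the groupoid $\mathsf{PaB}(n)$ are the parenthesized permutations of $1,\dots,n$. A morphism $\tau_1\to\tau_2$ is a braid $g\in\mathrm B_n$ with $\rho(g)=\mathfrak p(\tau_2)^{-1}\mathfrak p(\tau_1)$, where $\mathfrak p(\tau)\in S_n$ is the permutation underlying $\tau$. Composition is multiplication in $\mathrm B_n$, $S_n$ acts by relabeling, and $\gamma\circ_i\eta$ replaces the strand of $\gamma$ labeled by $i$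 by a thin version of $\eta$. Let $\beta:12\to21$ be the morphism with the underlying braid $\sigma_1$ and $\alpha:(12)3\to1(23)$ the morphism with the underlying braid $1$. Let $\mathsf{PaB}^{\le4}$ be the truncation of $\mathsf{PaB}$ to the arities at most $4$. Let $\varphi_{123},\varphi_{12,3,4},\varphi_{1,23,4},\varphi_{1,2,34},\varphi_{234}:\mathrm{PB}_3\to\mathrm{PB}_4$ be the homomorphisms that, respectively, add a straight strand on the right, double the first strand, double the second strand, double the third strand, and add a straight strand on the left; define $\varphi_{12},\varphi_{12,3},\varphi_{1,23},\varphi_{23}:\mathrm{PB}_2\to\mathrm{PB}_3$ in the same way. For $\mathrm N\in\mathsf{NFI}_{\mathrm{PB}_4}(\mathrm B_4)$ let $\mathrm N_{\mathrm{PB}_4}=\mathrm N$, let $\mathrm N_{\mathrm{PB}_3}\le \mathrm{PB}_3$ be the intersection of the preimages of $\mathrm N$ under the first five homomorphisms, let $\mathrm N_{\mathrm{PB}_2}\le\mathrm{PB}_2$ be the intersection of the preimages of $\mathrm N_{\mathrm{PB}_3}$ under the other four, and let $N_{\mathrm{ord}}=|\mathrm{PB}_2:\mathrm N_{\mathrm{PB}_2}|$.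 For two morphisms $\gamma,\gamma'$ of $\mathsf{PaB}(n)$, $2\le n\le4$, with a common source and a common target, put $\gamma\sim_{\mathrm N}\gamma'$ if $\gamma^{-1}\gamma'\in\mathrm N_{\mathrm{PB}_n}$; the quotient $\mathsf{PaB}^{\le4}/{\sim_{\mathrm N}}$ is a truncated operad in groupoids. **$\mathsf{GT}$-shadows.** A *$\mathsf{GT}$-pair* for $\mathrm N$ is a class $[(m,f)]=(m+N_{\mathrm{ord}}\mathbb Z,\ f\mathrm N_{\mathrm{PB}_3})$, $m\in\mathbb Z$, $f\in\mathrm{PB}_3$, such that $$\sigma_1x_{12}^m\,f^{-1}\sigma_2x_{23}^mf\,\mathrm N_{\mathrm{PB}_3}=f^{-1}\sigma_1\sigma_2(x_{13}x_{23})^m\,\mathrm N_{\mathrm{PB}_3},$$ $$f^{-1}\sigma_2x_{23}^mf\,\sigma_1x_{12}^m\,\mathrm N_{\mathrm{PB}_3}=\sigma_2\sigma_1(x_{12}x_{13})^mf\,\mathrm N_{\mathrm{PB}_3},$$ $$\varphi_{234}(f)\,\varphi_{1,23,4}(f)\,\varphi_{123}(f)\,\mathrm N=\varphi_{1,2,34}(f)\,\varphi_{12,3,4}(f)\,\mathrm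 N .$$ To such a pair corresponds the unique morphism of truncated operads $T_{m,f}:\mathsf{PaB}^{\le4}\to\mathsf{PaB}^{\le4}/{\sim_{\mathrm N}}$ that is the identity on objects and maps $\alpha$ to the class of $\alpha\cdot f$ and $\beta$ to the class of $\beta\cdot x_{12}^m$. On the automorphisms of the objects $12$, $(12)3$ and $((12)3)4$ it induces homomorphisms $T^{\mathrm{PB}_n}_{m,f}:\mathrm{PB}_n\to\mathrm{PB}_n/\mathrm N_{\mathrm{PB}_n}$ for $n=2,3,4$. A *$\mathsf{GT}$-shadow with the target $\mathrm N$* is a $\mathsf{GT}$-pair for which $T^{\mathrm{PB}_2}_{m,f}$, $T^{\mathrm{PB}_3}_{m,f}$ and $T^{\mathrm{PB}_4}_{m,f}$ are onto; its *source* is $\ker T^{\mathrm{PB}_4}_{m,f}$. It is *charming* if the coset $f\mathrm N_{\mathrm{PB}_3}$ contains an element of $[\mathrm F_2,\mathrm F_2]$ and the restriction of $T^{\mathrm{PB}_3}_{m,f}$ to $\mathrm F_2$ is onto $\mathrm F_2/(\mathrm N_{\mathrm{PB}_3}\cap\mathrm F_2)$ (regarded as the image of $\mathrm F_2$ in $\mathrm{PB}_3/\mathrm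 N_{\mathrm{PB}_3}$). Let $\mathsf{GTSh}^{\heartsuit}$ be the groupoid whose set of objects is $\mathsf{NFI}_{\mathrm{PB}_4}(\mathrm B_4)$ and whose morphisms from $\tilde{\mathrm N}$ to $\mathrm N$ are the charming $\mathsf{GT}$-shadows with the source $\tilde{\mathrm N}$ and the target $\mathrm N$. For $\mathrm N\in\mathsf{NFI}_{\mathrm{PB}_4}(\mathrm B_4)$ let $\mathrm N^{\sharp}$ be the intersection of all objects $\mathrm K$ in the connected component of $\mathrm N$ in $\mathsf{GTSh}^{\heartsuit}$. An element $\mathrm N$ of $\mathsf{NFI}_{\mathrm{PB}_4}(\mathrm B_4)$ is *isolated* if every charming $\mathsf{GT}$-shadow with the target $\mathrm N$ has the source $\mathrm N$, i.e. is an automorphism of $\mathrm N$ in $\mathsf{GTSh}^{\heartsuit}$. **Statement.** (1) For every $\mathrm N\in\mathsf{NFI}_{\mathrm{PB}_4}(\mathrm B_4)$, the subgroup $\mathrm N^{\sharp}$ belongs to $\mathsf{NFI}_{\mathrm{PB}_4}(\mathrm B_4)$ and is isolated. (2) The isolated elements form a cofinal subposet of $\mathsf{NFI}_{\mathrm{PB}_4}(\mathrm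 B_4)$: for every $\mathrm N\in\mathsf{NFI}_{\mathrm{PB}_4}(\mathrm B_4)$ there is an isolated $\mathrm K\in\mathsf{NFI}_{\mathrm{PB}_4}(\mathrm B_4)$ with $\mathrm K\le\mathrm N$. -/

import Mathlib

namespace GTShadows

open Equiv

/-- The defining relators of the Artin braid group on `n` strands; the generator with index `i`
(counted from `0`) is `σ_{i+1}`. -/
def braidRels (n : ℕ) : Set (FreeGroup (Fin (n - 1))) :=
  {r | ∃ i j : Fin (n - 1), (i.val + 2 ≤ j.val ∨ j.val + 2 ≤ i.val) ∧
    r = .of i * .of j * (.of i)⁻¹ * (.of j)⁻¹} ∪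
  {r | ∃ i j : Fin (n - 1), i.val + 1 = j.val ∧
    r = .of i * .of j * .of i * (.of j)⁻¹ * (.of i)⁻¹ * (.of j)⁻¹}

/-- The Artin braid group `B_n`. A product `g * h` is the braid `h` followed by the braid `g`. -/
abbrev B (n : ℕ) : Type := PresentedGroup (braidRels n)

/-- The standard generator of `B_n` that crosses the strands in the positions `i` and `i + 1`
(positions are counted from `0`); by convention it is `1` if there are no such positions. -/
def sig (n i : ℕ) : B n := if h : i < n - 1 then PresentedGroup.of ⟨i, h⟩ else 1

theorem sig_comm (n : ℕ) {i j : ℕ} (h : i + 2 ≤ j) : sig n i * sig n j = sig n j * sig n i := by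
  unfold sig
  split_ifs with h1 h2
  · rw [← mul_inv_eq_one, mul_inv_rev, ← mul_assoc]
    have := PresentedGroup.one_of_mem (rels := braidRels n)
      (x := .of ⟨i, h1⟩ * .of ⟨j, h2⟩ * (.of ⟨i, h1⟩)⁻¹ * (.of ⟨j, h2⟩)⁻¹)
      (Or.inl ⟨⟨i, h1⟩, ⟨j, h2⟩, Or.inl h, rfl⟩)
    simpa [PresentedGroup.of] using this
  all_goals simp

theorem sig_braid (n : ℕ) {i : ℕ} (h : i + 2 < n) :
    sig n i * sig n (i + 1) * sig n i = sig n (i + 1) * sig n i * sig n (i + 1) := by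
  have h1 : i < n - 1 := by omega
  have h2 : i + 1 < n - 1 := by omega
  unfold sig
  rw [dif_pos h1, dif_pos h2, ← mul_inv_eq_one, mul_inv_rev, mul_inv_rev, ← mul_assoc,
    ← mul_assoc]
  have := PresentedGroup.one_of_mem (rels := braidRels n)
    (x := .of ⟨i, h1⟩ * .of ⟨i + 1, h2⟩ * .of ⟨i, h1⟩ * (.of ⟨i + 1, h2⟩)⁻¹ * (.of ⟨i, h1⟩)⁻¹ *
      (.of ⟨i + 1, h2⟩)⁻¹)
    (Or.inr ⟨⟨i, h1⟩, ⟨i + 1, h2⟩, rfl, rfl⟩)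
  simpa [PresentedGroup.of] using this

/-- The homomorphism out of `B_n` with prescribed values on the standard generators. -/
def liftB {G : Type*} [Group G] (n : ℕ) (s : ℕ → G)
    (hc : ∀ i j, i + 2 ≤ j → j + 1 < n → s i * s j = s j * s i)
    (hb : ∀ i, i + 2 < n → s i * s (i + 1) * s i = s (i + 1) * s i * s (i + 1)) : B n →* G :=
  PresentedGroup.toGroup (f := fun i : Fin (n - 1) => s i) (by
    rintro r (⟨i, j, h | h, rfl⟩ | ⟨i, j, h, rfl⟩)
    · have := hc i j h (by omega)
      simp [this]
    · have := hc j i h (by omega)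
      simp [← this]
    · have := hb i (by omega)
      simp [← h, this])

theorem liftB_sig {G : Type*} [Group G] (n : ℕ) (s : ℕ → G) (hc hb) {i : ℕ} (h : i + 1 < n) :
    liftB n s hc hb (sig n i) = s i := by
  have h1 : i < n - 1 := by omega
  simp [liftB, sig, h1, PresentedGroup.toGroup.of]

theorem B_induction {n : ℕ} {P : B n → Prop} (h1 : P 1) (hs : ∀ i, i + 1 < n → P (sig n i))
    (hm : ∀ g h, P g → P h → P (g * h)) (hi : ∀ g, P g → P g⁻¹) (g : B n) : P g := by
  have : g ∈ Subgroup.closure (Set.range (PresentedGroup.of (rels := braidRels n))) := by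
    rw [PresentedGroup.closure_range_of]; trivial
  induction this using Subgroup.closure_induction with
  | mem x hx =>
    obtain ⟨i, rfl⟩ := hx
    have := hs i (by omega)
    simpa [sig] using this
  | one => exact h1
  | mul x y _ _ hx hy => exact hm x y hx hy
  | inv x _ hx => exact hi x hx

/-- The adjacent transposition of the positions `i` and `i + 1`. -/
def adj (n i : ℕ) : Perm (Fin n) :=
  if h : i + 1 < n then swap ⟨i, by omega⟩ ⟨i + 1, h⟩ else 1

theorem adj_val (n i : ℕ) (k : Fin n) : (adj n i k).val =
    if i + 1 < n then if k.val = i then i + 1 else if k.val = i + 1 then i else k.val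
      else k.val := by
  unfold adj
  split_ifs <;> simp_all [swap_apply_def, Fin.ext_iff]

/-- The standard homomorphism `ρ : B_n → S_n`; `ρ g` sends the position at which a strand of `g`
originates to the position at which it ends. -/
def rho (n : ℕ) : B n →* Perm (Fin n) :=
  liftB n (adj n)
    (by
      intro i j h hj; ext k; simp only [Perm.mul_apply, adj_val]; grind)
    (by
      intro i h; ext k; simp only [Perm.mul_apply, adj_val]; grind)

theorem rho_sig {n i : ℕ} (h : i + 1 < n) : rho n (sig n i) = adj n i := liftB_sig _ _ _ _ h

/-- The pure braid group. -/
def PB (n : ℕ) : Subgroup (B n) := (rho n).ker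

theorem mem_PB {n : ℕ} {g : B n} : g ∈ PB n ↔ rho n g = 1 := Iff.rfl

/-- The permutation `(k, b) ↦ (π k, c k * b)`. -/
def twist {α G : Type*} [Group G] (π : Perm α) (c : α → G) : Perm (α × G) where
  toFun x := (π x.1, c x.1 * x.2)
  invFun x := (π⁻¹ x.1, (c (π⁻¹ x.1))⁻¹ * x.2)
  left_inv x := by simp
  right_inv x := by simp

theorem twist_mul {α G : Type*} [Group G] (π π' : Perm α) (c c' : α → G) :
    twist π c * twist π' c' = twist (π * π') (fun k => c (π' k) * c' k) := by
  ext x <;> simp [twist, mul_assoc]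

/-- The braid obtained from the generator `sig n i` by doubling the strand that originates in the
position `k`. -/
def dblGen (n i k : ℕ) : B (n + 1) :=
  if k < i then sig (n + 1) (i + 1)
  else if k = i then sig (n + 1) i * sig (n + 1) (i + 1)
  else if k = i + 1 then sig (n + 1) (i + 1) * sig (n + 1) i
  else sig (n + 1) i

theorem braid_aux {G : Type*} [Group G] {a b c : G} (h1 : a * b * a = b * a * b)
    (h2 : b * c * b = c * b * c) (h3 : a * c = c * a) :
    a * (b * c) * (a * b) = b * c * (a * b) * c ∧
    a * b * c * (b * a) = c * (b * a) * (b * c) ∧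
    b * a * (c * b) * a = c * (b * a) * (c * b) := by
  refine ⟨?_, ?_, ?_⟩
  · calc a * (b * c) * (a * b) = a * b * (c * a) * b := by group
      _ = (a * b * a) * (c * b) := by rw [← h3]; group
      _ = b * a * (b * c * b) := by rw [h1]; group
      _ = b * (a * c) * b * c := by rw [h2]; group
      _ = _ := by rw [h3]; group
  · calc a * b * c * (b * a) = a * (b * c * b) * a := by group
      _ = (a * c) * b * (c * a) := by rw [h2]; group
      _ = c * (a * b * a) * c := by rw [← h3, h3]; simp only [mul_assoc, h3]
      _ = _ := by rw [h1]; group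
  · calc b * a * (c * b) * a = b * (a * c) * (b * a) := by group
      _ = b * c * (a * b * a) := by rw [h3]; group
      _ = (b * c * b) * a * b := by rw [h1]; group
      _ = c * b * (c * a) * b := by rw [h2]; group
      _ = _ := by rw [← h3]; group

theorem dblGen_lt {n i k : ℕ} (h : k < i) : dblGen n i k = sig (n + 1) (i + 1) := by
  simp [dblGen, h]

theorem dblGen_self {n i : ℕ} : dblGen n i i = sig (n + 1) i * sig (n + 1) (i + 1) := by
  simp [dblGen]

theorem dblGen_succ {n i : ℕ} : dblGen n i (i + 1) = sig (n + 1) (i + 1) * sig (n + 1) i := by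
  simp [dblGen]

theorem dblGen_gt {n i k : ℕ} (h : i + 1 < k) : dblGen n i k = sig (n + 1) i := by
  have h1 : ¬ k < i ∧ k ≠ i ∧ k ≠ i + 1 := by omega
  simp [dblGen, h1]

theorem dbl_comm (n : ℕ) {i j : ℕ} (h : i + 2 ≤ j) (hj : j + 1 < n) (k : Fin n) :
    dblGen n i (adj n j k) * dblGen n j k = dblGen n j (adj n i k) * dblGen n i k := by
  have e1 : Commute _ _ := sig_comm (n + 1) (i := i) (j := j) h
  have e2 : Commute _ _ := sig_comm (n + 1) (i := i) (j := j + 1) (by omega)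
  have e3 : Commute _ _ := sig_comm (n + 1) (i := i + 1) (j := j + 1) (by omega)
  have hi : i + 1 < n := by omega
  rw [adj_val, adj_val, if_pos hi, if_pos hj]
  obtain ⟨k, hk⟩ := k
  simp only
  have c1 : k < i ∨ k = i ∨ k = i + 1 ∨ (i + 1 < k ∧ k < j) ∨ k = j ∨ k = j + 1 ∨ j + 1 < k := by
    omega
  rcases c1 with c | c | c | c | c | c | c
  · rw [if_neg (by omega), if_neg (by omega), if_neg (by omega), if_neg (by omega), dblGen_lt c,
      dblGen_lt (by omega)]
    exact e3
  · subst c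
    rw [if_neg (by omega), if_neg (by omega), if_pos rfl, dblGen_self, dblGen_lt (by omega),
      dblGen_lt (by omega)]
    exact e2.mul_left e3
  · subst c
    rw [if_neg (by omega), if_neg (by omega), if_neg (by omega), if_pos rfl, dblGen_succ,
      dblGen_lt (by omega), dblGen_lt (by omega)]
    exact e3.mul_left e2
  · rw [if_neg (by omega), if_neg (by omega), if_neg (by omega), if_neg (by omega),
      dblGen_gt c.1, dblGen_lt c.2]
    exact e2
  · subst c
    rw [if_pos rfl, if_neg (by omega), if_neg (by omega), dblGen_self, dblGen_gt (by omega),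
      dblGen_gt (by omega)]
    exact e1.mul_right e2
  · subst c
    rw [if_neg (by omega), if_pos rfl, if_neg (by omega), if_neg (by omega), dblGen_succ,
      dblGen_gt (by omega), dblGen_gt (by omega)]
    exact e2.mul_right e1
  · rw [if_neg (by omega), if_neg (by omega), if_neg (by omega), if_neg (by omega),
      dblGen_gt (by omega), dblGen_gt c]
    exact e1

theorem dbl_braid (n : ℕ) {i : ℕ} (h : i + 2 < n) (k : Fin n) :
    dblGen n i ((adj n (i + 1) * adj n i) k) * (dblGen n (i + 1) (adj n i k) * dblGen n i k) =
      dblGen n (i + 1) ((adj n i * adj n (i + 1)) k) *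
        (dblGen n i (adj n (i + 1) k) * dblGen n (i + 1) k) := by
  have e1 := sig_braid (n + 1) (i := i) (by omega)
  have e2 := sig_braid (n + 1) (i := i + 1) (by omega)
  have e3 := sig_comm (n + 1) (i := i) (j := i + 1 + 1) (by omega)
  obtain ⟨e4, e5, e6⟩ := braid_aux e1 e2 e3
  have a0 : ((adj n (i + 1) * adj n i) k).val = if k.val = i then i + 2 else
      if k.val = i + 1 then i else if k.val = i + 2 then i + 1 else k.val := by
    rw [Perm.mul_apply, adj_val, adj_val]; grind
  have a1 : ((adj n i * adj n (i + 1)) k).val = if k.val = i then i + 1 else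
      if k.val = i + 1 then i + 2 else if k.val = i + 2 then i else k.val := by
    rw [Perm.mul_apply, adj_val, adj_val]; grind
  have hi : i + 1 < n := by omega
  rw [a0, a1, adj_val, adj_val, if_pos hi, if_pos h]
  clear a0 a1
  obtain ⟨k, hk⟩ := k
  simp only
  have c1 : k < i ∨ k = i ∨ k = i + 1 ∨ k = i + 1 + 1 ∨ i + 1 + 1 < k := by omega
  rcases c1 with c | c | c | c | c
  · have h1 : k ≠ i ∧ k ≠ i + 1 ∧ k ≠ i + 2 := by omega
    simp only [h1, if_false]
    rw [dblGen_lt c, dblGen_lt (by omega)]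
    simpa only [mul_assoc] using e2
  · subst c
    have h1 : k ≠ k + 1 ∧ k ≠ k + 2 := by omega
    simp only [h1, if_false, if_true]
    rw [dblGen_gt (by omega), dblGen_self, dblGen_self, dblGen_lt (by omega)]
    simpa only [mul_assoc] using e4
  · subst c
    have h1 : i + 1 ≠ i ∧ i + 1 ≠ i + 2 := by omega
    simp only [h1, if_false, if_true]
    rw [dblGen_self, dblGen_lt (by omega), dblGen_succ, dblGen_succ, dblGen_gt (by omega),
      dblGen_self]
    simpa only [mul_assoc] using e5
  · subst c
    have h1 : i + 1 + 1 ≠ i ∧ i + 1 + 1 ≠ i + 1 := by omega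
    simp only [h1, if_false, if_true]
    rw [dblGen_succ, dblGen_succ, dblGen_gt (by omega), dblGen_lt (by omega)]
    simpa only [mul_assoc] using e6
  · have h1 : k ≠ i ∧ k ≠ i + 1 ∧ k ≠ i + 2 ∧ k ≠ i + 1 + 1 := by omega
    simp only [h1, if_false]
    rw [dblGen_gt (by omega), dblGen_gt c]
    simpa only [mul_assoc] using e1

/-- The action of `B_n` on `Fin n × B_{n+1}` in which a generator moves the position `k` by its
permutation and multiplies the second factor by the generator with the strand at `k` doubled. -/
def dblHom (n : ℕ) : B n →* Perm (Fin n × B (n + 1)) :=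
  liftB n (fun i => twist (adj n i) (fun k => dblGen n i k))
    (by
      intro i j h hj
      simp only [twist_mul, dbl_comm n h hj]
      congr 1
      ext k; simp only [Perm.mul_apply, adj_val]; grind)
    (by
      intro i h
      rw [mul_assoc, mul_assoc, twist_mul, twist_mul, twist_mul, twist_mul]
      congr 1
      · ext k; simp only [Perm.mul_apply, adj_val]; grind
      · funext k; exact dbl_braid n h k)

/-- The braid on `n + 1` strands obtained from `g` by doubling (replacing by two parallel strands)
the strand of `g` that originates in the position `k`. -/
def dbl {n : ℕ} (k : Fin n) (g : B n) : B (n + 1) := (dblHom n g (k, 1)).2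

theorem dblHom_apply {n : ℕ} (g : B n) : ∀ (k : Fin n) (b : B (n + 1)),
    dblHom n g (k, b) = (rho n g k, dbl k g * b) := by
  have key : ∀ g : B n, ∃ c : Fin n → B (n + 1), dblHom n g = twist (rho n g) c := by
    refine B_induction ⟨fun _ => 1, ?_⟩ ?_ ?_ ?_
    · ext x <;> simp [twist]
    · intro i hi
      exact ⟨_, by rw [rho_sig hi]; exact liftB_sig _ _ _ _ hi⟩
    · rintro g h ⟨c, hc⟩ ⟨d, hd⟩
      exact ⟨_, by rw [map_mul, map_mul, hc, hd, twist_mul]⟩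
    · rintro g ⟨c, hc⟩
      refine ⟨fun k => (c ((rho n g)⁻¹ k))⁻¹, ?_⟩
      rw [map_inv, inv_eq_iff_mul_eq_one, hc, map_inv, twist_mul]
      ext x <;> simp [twist]
  obtain ⟨c, hc⟩ := key g
  intro k b
  simp [dbl, hc, twist]

theorem dbl_mul {n : ℕ} (k : Fin n) (g h : B n) :
    dbl k (g * h) = dbl (rho n h k) g * dbl k h := by
  have := dblHom_apply (g * h) k 1
  rw [map_mul, Perm.mul_apply, dblHom_apply, dblHom_apply] at this
  simpa using (congrArg Prod.snd this).symm

theorem dbl_one {n : ℕ} (k : Fin n) : dbl k (1 : B n) = 1 := by simp [dbl]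

theorem dbl_sig {n i : ℕ} (k : Fin n) (h : i + 1 < n) : dbl k (sig n i) = dblGen n i k := by
  simp [dbl, dblHom, liftB_sig _ _ _ _ h, twist]

/-- The braid obtained from `g` by replacing the strand that originates in the position `k` by
`m + 1` parallel strands. -/
def cable {n : ℕ} (k : Fin n) : (m : ℕ) → B n → B (n + m)
  | 0, g => g
  | m + 1, g => dbl (Fin.castAdd m k) (cable k m g)

/-- The homomorphism `B_{m+1} → B_{n+m}` that places a braid on `m + 1` strands in the positions
`k, …, k + m` and adds straight strands in the other positions. -/
def shift {n : ℕ} (k : Fin n) (m : ℕ) : B (m + 1) →* B (n + m) :=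
  liftB (m + 1) (fun j => sig (n + m) (k.val + j))
    (fun i j h _ => sig_comm _ (by omega))
    (fun i h => by
      have := sig_braid (n + m) (i := k.val + i) (by omega)
      simpa [add_assoc] using this)

/-- Operadic insertion of braids: the strand of `g` that originates in the position `k` is replaced
by a thin version of `h`. -/
def insBraid {n m : ℕ} (k : Fin n) (g : B n) (h : B (m + 1)) : B (n + m) :=
  cable k m g * shift k m h

/-- The map `Fin (m + 1) → Fin (n + m)` onto the block that replaces `k`. -/
def inBlock {n : ℕ} (k : Fin n) (m : ℕ) (l : Fin (m + 1)) : Fin (n + m) :=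
  ⟨k.val + l.val, by omega⟩

/-- The new name of `j ≠ k` after `k` has been replaced by a block of size `m + 1`. -/
def outBlock {n : ℕ} (k : Fin n) (m : ℕ) (j : Fin n) : Fin (n + m) :=
  if j < k then ⟨j.val, by omega⟩ else ⟨j.val + m, by omega⟩

theorem block_cases {n m : ℕ} (k : Fin n) (x : Fin (n + m)) :
    (∃ l, x = inBlock k m l) ∨ ∃ j, j ≠ k ∧ x = outBlock k m j := by
  obtain ⟨x, hx⟩ := x
  by_cases h1 : x < k.val
  · exact Or.inr ⟨⟨x, by omega⟩, by simp [Fin.ext_iff]; omega, by simp [outBlock, Fin.lt_def, h1]⟩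
  by_cases h2 : x ≤ k.val + m
  · exact Or.inl ⟨⟨x - k.val, by omega⟩, by simp [inBlock]; omega⟩
  · refine Or.inr ⟨⟨x - m, by omega⟩, by simp [Fin.ext_iff]; omega, ?_⟩
    have : ¬ x - m < k.val := by omega
    simp [outBlock, Fin.lt_def, this]; omega

theorem rho_dbl {n : ℕ} (g : B n) : ∀ k : Fin n,
    (∀ l, rho (n + 1) (dbl k g) (inBlock k 1 l) = inBlock (rho n g k) 1 l) ∧
    ∀ j, j ≠ k → rho (n + 1) (dbl k g) (outBlock k 1 j) = outBlock (rho n g k) 1 (rho n g j) := by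
  induction g using B_induction with
  | h1 => intro k; simp [dbl_one]
  | hs i hi =>
    intro k
    rw [dbl_sig k hi, rho_sig hi]
    have a1 := rho_sig (n := n + 1) (i := i) (by omega)
    have a2 := rho_sig (n := n + 1) (i := i + 1) (by omega)
    constructor
    · intro l
      ext
      unfold dblGen
      have hl := l.2
      split_ifs <;> simp only [map_mul, Perm.mul_apply, a1, a2, adj_val, inBlock] <;> grind
    · intro j hj
      have hj' : j.val ≠ k.val := fun h => hj (Fin.ext h)
      ext
      unfold dblGen outBlock
      have e1 : (adj n i j < adj n i k) ↔ (adj n i j).val < (adj n i k).val := Iff.rfl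
      have e2 : (j < k) ↔ j.val < k.val := Iff.rfl
      simp only [e1, e2, adj_val]
      split_ifs <;> simp only [map_mul, Perm.mul_apply, a1, a2, adj_val] <;> grind
  | hm g h hg hh =>
    intro k
    rw [dbl_mul]
    simp only [map_mul, Perm.mul_apply]
    refine ⟨fun l => by rw [(hh k).1, (hg _).1], fun j hj => ?_⟩
    rw [(hh k).2 j hj, (hg _).2]
    simpa using hj
  | hi g hg =>
    intro k
    have e : dbl k g⁻¹ = (dbl ((rho n g)⁻¹ k) g)⁻¹ := by
      have := dbl_mul k g g⁻¹
      rw [mul_inv_cancel, dbl_one, map_inv] at this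
      exact (inv_eq_of_mul_eq_one_right this.symm).symm
    rw [e]
    simp only [map_inv, Perm.inv_eq_iff_eq]
    refine ⟨fun l => ?_, fun j hj => ?_⟩
    · rw [(hg _).1]; simp
    · rw [(hg _).2 _ (by simpa using hj)]; simp

theorem rho_cable {n : ℕ} (g : B n) (k : Fin n) (m : ℕ) :
    (∀ l, rho (n + m) (cable k m g) (inBlock k m l) = inBlock (rho n g k) m l) ∧
    ∀ j, j ≠ k → rho (n + m) (cable k m g) (outBlock k m j) =
      outBlock (rho n g k) m (rho n g j) := by
  induction m with
  | zero =>
    refine ⟨fun l => ?_, fun j _ => ?_⟩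
    · ext; simp [inBlock, cable]
    · ext; simp [outBlock, cable]
  | succ m ih =>
    have hK : ∀ k : Fin n, Fin.castAdd m k = inBlock k m 0 := fun k => by ext; simp [inBlock]
    have hr : rho (n + m) (cable k m g) (Fin.castAdd m k) = Fin.castAdd m (rho n g k) := by
      rw [hK, ih.1, hK]
    have D := rho_dbl (cable k m g) (Fin.castAdd m k)
    rw [hr] at D
    have hin : ∀ (k : Fin n) (l : Fin (m + 1 + 1)), 2 ≤ l.val →
        (inBlock k (m + 1) l : Fin (n + m + 1)) =
          outBlock (Fin.castAdd m k) 1 (inBlock k m ⟨l.val - 1, by omega⟩) := by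
      intro k l hl
      ext
      simp [inBlock, outBlock, Fin.lt_def]
      omega
    have hin' : ∀ (k : Fin n) (l : Fin (m + 1 + 1)) (h : l.val < 2),
        (inBlock k (m + 1) l : Fin (n + m + 1)) =
          inBlock (Fin.castAdd m k) 1 ⟨l.val, h⟩ := by
      intro k l hl
      ext
      simp [inBlock]
    have hout : ∀ k j : Fin n, (outBlock k (m + 1) j : Fin (n + m + 1)) =
        outBlock (Fin.castAdd m k) 1 (outBlock k m j) := by
      intro k j
      ext
      simp only [outBlock, Fin.lt_def, Fin.val_castAdd]
      grind
    refine ⟨fun l => ?_, fun j hj => ?_⟩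
    · rcases Nat.lt_or_ge l.val 2 with h | h
      · exact (congrArg _ (hin' k l h)).trans ((D.1 _).trans (hin' _ l h).symm)
      · refine (congrArg _ (hin k l h)).trans ((D.2 _ ?_).trans ?_)
        · simp only [ne_eq, Fin.ext_iff, inBlock, Fin.val_castAdd]; omega
        · rw [ih.1]; exact (hin _ l h).symm
    · refine (congrArg _ (hout k j)).trans ((D.2 _ ?_).trans ?_)
      · have : j.val ≠ k.val := fun h => hj (Fin.ext h)
        simp only [ne_eq, Fin.ext_iff, outBlock, Fin.val_castAdd, Fin.lt_def]
        grind
      · rw [ih.2 j hj]; exact (hout _ _).symm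

theorem rho_shift {n : ℕ} (k : Fin n) (m : ℕ) (h : B (m + 1)) :
    (∀ l, rho (n + m) (shift k m h) (inBlock k m l) = inBlock k m (rho (m + 1) h l)) ∧
    ∀ j, j ≠ k → rho (n + m) (shift k m h) (outBlock k m j) = outBlock k m j := by
  induction h using B_induction with
  | h1 => simp
  | hs i hi =>
    have e : shift k m (sig (m + 1) i) = sig (n + m) (k.val + i) := liftB_sig _ _ _ _ hi
    rw [e, rho_sig (by omega), rho_sig hi]
    refine ⟨fun l => ?_, fun j hj => ?_⟩
    · ext
      simp only [adj_val, inBlock]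
      grind
    · have : j.val ≠ k.val := fun h => hj (Fin.ext h)
      ext
      simp only [adj_val, outBlock, Fin.lt_def]
      grind
  | hm g h hg hh =>
    simp only [map_mul, Perm.mul_apply]
    exact ⟨fun l => by rw [hh.1, hg.1], fun j hj => by rw [hh.2 j hj, hg.2 j hj]⟩
  | hi g hg =>
    simp only [map_inv, Perm.inv_eq_iff_eq]
    refine ⟨fun l => ?_, fun j hj => (hg.2 j hj).symm⟩
    rw [hg.1]; simp

theorem cable_mul {n : ℕ} (k : Fin n) (m : ℕ) (g h : B n) :
    cable k m (g * h) = cable (rho n h k) m g * cable k m h := by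
  induction m with
  | zero => rfl
  | succ m ih =>
    have hr : rho (n + m) (cable k m h) (Fin.castAdd m k) = Fin.castAdd m (rho n h k) := by
      have := (rho_cable h k m).1 0
      have hK : ∀ k : Fin n, Fin.castAdd m k = inBlock k m 0 := fun k => by ext; simp [inBlock]
      rw [hK, this, hK]
    change dbl (Fin.castAdd m k) (cable k m (g * h)) =
      dbl (Fin.castAdd m (rho n h k)) (cable (rho n h k) m g) *
        dbl (Fin.castAdd m k) (cable k m h)
    rw [ih, dbl_mul, hr]

/-- The sequence of generators of a word in a free magma. -/
def leaves {α : Type} : FreeMagma α → List α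
  | .of x => [x]
  | .mul s t => leaves s ++ leaves t

theorem leaves_of {α : Type} (x : α) : leaves (.of x) = [x] := rfl

theorem leaves_mul {α : Type} (s t : FreeMagma α) : leaves (s * t) = leaves s ++ leaves t := rfl

theorem leaves_bind {α β : Type} (t : FreeMagma α) (f : α → FreeMagma β) :
    leaves (t >>= f) = (leaves t).flatMap (fun a => leaves (f a)) := by
  induction t with
  | ih1 x =>
    change leaves (f x) = [x].flatMap _
    simp
  | ih2 s t hs ht =>
    have : (s * t >>= f) = (s >>= f) * (t >>= f) := rfl
    rw [this, leaves_mul, hs, ht, leaves_mul]; simp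

theorem leaves_map {α β : Type} (t : FreeMagma α) (f : α → β) :
    leaves (f <$> t) = (leaves t).map f := by
  induction t with
  | ih1 x => rfl
  | ih2 s t hs ht =>
    have : (f <$> (s * t)) = (f <$> s) * (f <$> t) := rfl
    rw [this, leaves_mul, hs, ht, leaves_mul]; simp

/-- The objects of `PaB(n)`: words of the free magma on the labels `0, …, n - 1` in which each
label appears exactly once. -/
def Ob (n : ℕ) : Type := {t : FreeMagma (Fin n) // (leaves t).Nodup ∧ ∀ j, j ∈ leaves t}

theorem Ob.length_leaves {n : ℕ} (τ : Ob n) : (leaves τ.1).length = n := by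
  have := Fintype.card_congr (τ.2.1.getEquivOfForallMemList _ τ.2.2)
  simpa using this

/-- The permutation underlying an object of `PaB(n)`: it sends a position to the label at this
position. -/
def Ob.label {n : ℕ} (τ : Ob n) : Perm (Fin n) :=
  (finCongr τ.length_leaves.symm).trans (τ.2.1.getEquivOfForallMemList _ τ.2.2)

theorem Ob.label_spec {n : ℕ} (τ : Ob n) (k : Fin n) :
    (leaves τ.1)[k.val]? = some (τ.label k) := by
  simp [Ob.label, τ.length_leaves]

theorem Ob.label_eq {n : ℕ} (τ : Ob n) {k j : Fin n} (h : (leaves τ.1)[k.val]? = some j) :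
    τ.label k = j := by
  rw [τ.label_spec] at h; exact Option.some.inj h

/-- The action of the symmetric group on objects. -/
def Ob.act {n : ℕ} (θ : Perm (Fin n)) (τ : Ob n) : Ob n :=
  ⟨(θ : Fin n → Fin n) <$> τ.1, by
    rw [leaves_map]
    refine ⟨τ.2.1.map θ.injective, fun j => ?_⟩
    exact List.mem_map.2 ⟨θ⁻¹ j, τ.2.2 _, by simp⟩⟩

theorem Ob.label_act {n : ℕ} (θ : Perm (Fin n)) (τ : Ob n) : (τ.act θ).label = θ * τ.label := by
  ext1 k
  apply Ob.label_eq
  simp [Ob.act, leaves_map, τ.label_spec]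

/-- The letter or word that replaces the letter `j` when `σ` is inserted at the label `i`. -/
def insLetter {n m : ℕ} (i : Fin n) (σ : FreeMagma (Fin (m + 1))) (j : Fin n) :
    FreeMagma (Fin (n + m)) :=
  if j = i then inBlock i m <$> σ else .of (outBlock i m j)

theorem inBlock_inj {n m : ℕ} (i : Fin n) : Function.Injective (inBlock i m) := by
  intro a b h; ext; simpa [inBlock] using h

theorem outBlock_inj {n m : ℕ} (i : Fin n) {a b : Fin n} (ha : a ≠ i) (hb : b ≠ i)
    (h : outBlock i m a = outBlock i m b) : a = b := by
  have h1 := congrArg Fin.val h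
  simp only [outBlock, Fin.lt_def] at h1
  grind

theorem inBlock_ne {n m : ℕ} (i : Fin n) (l : Fin (m + 1)) {j : Fin n} (hj : j ≠ i) :
    inBlock i m l ≠ outBlock i m j := by
  intro h
  have h1 := congrArg Fin.val h
  simp only [outBlock, inBlock, Fin.lt_def] at h1
  grind

/-- The elementary insertion `τ ∘_i σ` on objects. -/
def Ob.ins {n m : ℕ} (τ : Ob n) (i : Fin n) (σ : Ob (m + 1)) : Ob (n + m) :=
  ⟨τ.1 >>= insLetter i σ.1, by
    rw [leaves_bind]
    constructor
    · rw [List.nodup_flatMap]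
      constructor
      · intro j _
        unfold insLetter
        split_ifs
        · rw [leaves_map]; exact σ.2.1.map (inBlock_inj i)
        · simp [leaves_of]
      · refine τ.2.1.imp ?_
        intro a b hab
        simp only [Function.onFun, insLetter]
        intro x hx hx'
        split_ifs at hx hx' with h1 h2 h2
        · exact hab (h1.trans h2.symm)
        · simp only [leaves_map, leaves_of, List.mem_map, List.mem_singleton] at hx hx'
          obtain ⟨l, _, rfl⟩ := hx
          exact inBlock_ne i l h2 hx'
        · simp only [leaves_map, leaves_of, List.mem_map, List.mem_singleton] at hx hx'
          obtain ⟨l, _, rfl⟩ := hx'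
          exact inBlock_ne i l h1 hx
        · simp only [leaves_of, List.mem_singleton] at hx hx'
          exact hab (outBlock_inj i h1 h2 (hx.symm.trans hx'))
    · intro x
      rw [List.mem_flatMap]
      rcases block_cases i x with ⟨l, rfl⟩ | ⟨j, hj, rfl⟩
      · refine ⟨i, τ.2.2 i, ?_⟩
        simp only [insLetter, if_true, leaves_map]
        exact List.mem_map.2 ⟨l, σ.2.2 l, rfl⟩
      · refine ⟨j, τ.2.2 j, ?_⟩
        simp [insLetter, hj, leaves_of]⟩

theorem Ob.label_ins {n m : ℕ} (τ : Ob n) (k : Fin n) (σ : Ob (m + 1)) :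
    (∀ l, (τ.ins (τ.label k) σ).label (inBlock k m l) = inBlock (τ.label k) m (σ.label l)) ∧
    ∀ j, j ≠ k → (τ.ins (τ.label k) σ).label (outBlock k m j) =
      outBlock (τ.label k) m (τ.label j) := by
  set i := τ.label k with hi
  have hlen : (leaves τ.1).length = n := τ.length_leaves
  have hk : k.val < (leaves τ.1).length := by omega
  have hget : (leaves τ.1)[k.val] = i := by
    have := τ.label_spec k
    rw [List.getElem?_eq_getElem hk] at this
    exact Option.some.inj this
  have hsplit : leaves τ.1 =
      (leaves τ.1).take k.val ++ i :: (leaves τ.1).drop (k.val + 1) := by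
    conv_lhs => rw [← List.take_append_drop k.val (leaves τ.1), List.drop_eq_getElem_cons hk, hget]
  have hnd := τ.2.1
  rw [hsplit] at hnd
  have hA : i ∉ (leaves τ.1).take k.val := fun h =>
    (List.nodup_append.1 hnd).2.2 i h i (by simp) rfl
  have hC : i ∉ (leaves τ.1).drop (k.val + 1) :=
    (List.nodup_cons.1 (List.nodup_append.1 hnd).2.1).1
  have hmap : ∀ L : List (Fin n), i ∉ L →
      L.flatMap (fun a => leaves (insLetter i σ.1 a)) = L.map (outBlock i m) := by
    intro L hL
    induction L with
    | nil => rfl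
    | cons a L ih =>
      simp only [List.mem_cons, not_or] at hL
      rw [List.flatMap_cons, ih hL.2, insLetter, if_neg (Ne.symm hL.1)]
      rfl
  have key : leaves (τ.ins i σ).1 = ((leaves τ.1).take k.val).map (outBlock i m) ++
      ((leaves σ.1).map (inBlock i m) ++
        ((leaves τ.1).drop (k.val + 1)).map (outBlock i m)) := by
    change leaves (τ.1 >>= insLetter i σ.1) = _
    rw [leaves_bind]
    conv_lhs => rw [hsplit]
    rw [List.flatMap_append, List.flatMap_cons, hmap _ hA, hmap _ hC, insLetter, if_pos rfl,
      leaves_map]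
  have hσ : (leaves σ.1).length = m + 1 := σ.length_leaves
  have hlA : ((leaves τ.1).take k.val).length = k.val := by simp; omega
  refine ⟨fun l => ?_, fun j hj => ?_⟩
  · apply Ob.label_eq
    rw [key, List.getElem?_append_right (by simp [inBlock]), List.getElem?_append_left]
    · rw [List.getElem?_map]
      have : (inBlock k m l).val - ((List.take k.val (leaves τ.1)).map (outBlock i m)).length
          = l.val := by simp [inBlock]; omega
      rw [this, σ.label_spec]; rfl
    · simp [inBlock, hσ]; omega
  · have hj' : j.val ≠ k.val := fun h => hj (Fin.ext h)
    apply Ob.label_eq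
    rw [key]
    rcases Nat.lt_or_ge j.val k.val with h | h
    · have e : (outBlock k m j).val = j.val := by simp [outBlock, Fin.lt_def, h]
      rw [e, List.getElem?_append_left (by simp; omega), List.getElem?_map, List.getElem?_take,
        if_pos h, τ.label_spec]
      rfl
    · have h' : ¬ j.val < k.val := by omega
      have e : (outBlock k m j).val = j.val + m := by simp [outBlock, Fin.lt_def, h']
      rw [e, List.getElem?_append_right (by simp; omega),
        List.getElem?_append_right (by simp; omega), List.getElem?_map, List.getElem?_drop]
      have : k.val + 1 + (j.val + m - ((List.take k.val (leaves τ.1)).map (outBlock i m)).length -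
          ((leaves σ.1).map (inBlock i m)).length) = j.val := by simp; omega
      rw [this, τ.label_spec]; rfl

/-- Morphisms of the groupoid `PaB(n)`: braids that connect equal labels. -/
def Hom {n : ℕ} (τ₁ τ₂ : Ob n) : Type := {g : B n // rho n g = τ₂.label⁻¹ * τ₁.label}

/-- Composition in `PaB(n)`; it is given by the multiplication in `B_n`. -/
def Hom.comp {n : ℕ} {τ₁ τ₂ τ₃ : Ob n} (γ : Hom τ₂ τ₃) (η : Hom τ₁ τ₂) : Hom τ₁ τ₃ :=
  ⟨γ.1 * η.1, by rw [map_mul, γ.2, η.2]; group⟩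

/-- The action of the symmetric group on morphisms; the underlying braid does not change. -/
def Hom.act {n : ℕ} {τ₁ τ₂ : Ob n} (θ : Perm (Fin n)) (γ : Hom τ₁ τ₂) :
    Hom (τ₁.act θ) (τ₂.act θ) :=
  ⟨γ.1, by rw [γ.2, Ob.label_act, Ob.label_act]; group⟩

/-- The elementary insertion `γ ∘_i η` on morphisms: the strand of `γ` that originates in the
position labeled by `i` is replaced by a thin version of `η`. -/
def Hom.ins {n m : ℕ} {τ₁ τ₂ : Ob n} {σ₁ σ₂ : Ob (m + 1)} (γ : Hom τ₁ τ₂) (i : Fin n)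
    (η : Hom σ₁ σ₂) : Hom (τ₁.ins i σ₁) (τ₂.ins i σ₂) :=
  ⟨insBraid (τ₁.label⁻¹ i) γ.1 η.1, by
    rw [eq_inv_mul_iff_mul_eq]
    obtain ⟨k, rfl⟩ := τ₁.label.surjective i
    have hk : τ₁.label⁻¹ (τ₁.label k) = k := by simp
    have hγ : ∀ j, τ₂.label (rho n γ.1 j) = τ₁.label j := fun j => by rw [γ.2]; simp
    have hη : ∀ j, σ₂.label (rho (m + 1) η.1 j) = σ₁.label j := fun j => by rw [η.2]; simp
    rw [hk, insBraid]
    ext1 x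
    simp only [map_mul, Perm.mul_apply]
    have h2 := Ob.label_ins τ₂ (rho n γ.1 k) σ₂
    rw [hγ] at h2
    rcases block_cases k x with ⟨l, rfl⟩ | ⟨j, hj, rfl⟩
    · rw [(rho_shift k m η.1).1, (rho_cable γ.1 k m).1, h2.1, hη, (Ob.label_ins τ₁ k σ₁).1]
    · rw [(rho_shift k m η.1).2 j hj, (rho_cable γ.1 k m).2 j hj, h2.2 _ (by simpa using hj), hγ,
        (Ob.label_ins τ₁ k σ₁).2 j hj]⟩

/-- The identity morphism of an object. -/
def Hom.id {n : ℕ} (τ : Ob n) : Hom τ τ := ⟨1, by simp⟩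

/-- A pure braid, regarded as an automorphism of an object. -/
def Hom.endo {n : ℕ} (τ : Ob n) (h : PB n) : Hom τ τ := ⟨h.1, by simpa using mem_PB.1 h.2⟩

theorem sig_sq_mem (n i : ℕ) : sig n i ^ 2 ∈ PB n := by
  rw [mem_PB, map_pow]
  by_cases h : i + 1 < n
  · rw [rho_sig h]
    ext k
    simp only [pow_two, Perm.mul_apply, adj_val, Perm.one_apply]
    grind
  · have : ¬ i < n - 1 := by omega
    simp [sig, this]

/-- The standard generator `x_{i+1,i+2} = σ_{i+1}²` of the pure braid group. -/
def sigSq (n i : ℕ) : PB n := ⟨sig n i ^ 2, sig_sq_mem n i⟩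

theorem dbl_inv {n : ℕ} (k : Fin n) (g : B n) : dbl k g⁻¹ = (dbl ((rho n g)⁻¹ k) g)⁻¹ := by
  have := dbl_mul k g g⁻¹
  rw [mul_inv_cancel, dbl_one, map_inv] at this
  exact (inv_eq_of_mul_eq_one_right this.symm).symm

/-- The coface homomorphism on the pure braid group that doubles the strand in the position `k`. -/
def cofaceDbl {n : ℕ} (k : Fin n) : PB n →* B (n + 1) where
  toFun h := dbl k h.1
  map_one' := dbl_one k
  map_mul' g h := by
    have : rho n h.1 = 1 := h.2
    simp [dbl_mul, this]

/-- `φ_{123}(h) = ou(id₁₂ ∘₁ m(h))` -/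
def phi_123 : PB 3 →* B 4 := (shift (0 : Fin 2) 2).comp (PB 3).subtype

/-- `φ_{12,3,4}(h) = ou(m(h) ∘₁ id₁₂)` -/
def phi_12_3_4 : PB 3 →* B 4 := cofaceDbl 0

/-- `φ_{1,23,4}(h) = ou(m(h) ∘₂ id₁₂)` -/
def phi_1_23_4 : PB 3 →* B 4 := cofaceDbl 1

/-- `φ_{1,2,34}(h) = ou(m(h) ∘₃ id₁₂)` -/
def phi_1_2_34 : PB 3 →* B 4 := cofaceDbl 2

/-- `φ_{234}(h) = ou(id₁₂ ∘₂ m(h))` -/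
def phi_234 : PB 3 →* B 4 := (shift (1 : Fin 2) 2).comp (PB 3).subtype

/-- `φ_{12}(h) = ou(id₁₂ ∘₁ m(h))` -/
def phi_12 : PB 2 →* B 3 := (shift (0 : Fin 2) 1).comp (PB 2).subtype

/-- `φ_{12,3}(h) = ou(m(h) ∘₁ id₁₂)` -/
def phi_12_3 : PB 2 →* B 3 := cofaceDbl 0

/-- `φ_{1,23}(h) = ou(m(h) ∘₂ id₁₂)` -/
def phi_1_23 : PB 2 →* B 3 := cofaceDbl 1

/-- `φ_{23}(h) = ou(id₁₂ ∘₂ m(h))` -/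
def phi_23 : PB 2 →* B 3 := (shift (1 : Fin 2) 1).comp (PB 2).subtype

/-- The poset `NFI_{PB₄}(B₄)` of the normal subgroups of finite index in `B₄` that are contained
in `PB₄`, ordered by inclusion. -/
abbrev NFI : Type := {N : Subgroup (B 4) // N.Normal ∧ N.FiniteIndex ∧ N ≤ PB 4}

/-- The subgroup `N_{PB₃}` (as a subgroup of `B₃`). -/
def NPB3 (N : Subgroup (B 4)) : Subgroup (B 3) :=
  (N.comap phi_123 ⊓ N.comap phi_12_3_4 ⊓ N.comap phi_1_23_4 ⊓ N.comap phi_1_2_34 ⊓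
    N.comap phi_234).map (PB 3).subtype

/-- The subgroup `N_{PB₂}` (as a subgroup of `B₂`). -/
def NPB2 (N : Subgroup (B 4)) : Subgroup (B 2) :=
  ((NPB3 N).comap phi_12 ⊓ (NPB3 N).comap phi_12_3 ⊓ (NPB3 N).comap phi_1_23 ⊓
    (NPB3 N).comap phi_23).map (PB 2).subtype

/-- The subgroup `N_{PB_n}` of `B_n` for `n = 2, 3, 4`. The group `B₁` is trivial, and the values
for `n = 0` and `n > 4` play no role. -/
def NPB (N : NFI) : (n : ℕ) → Subgroup (B n)
  | 2 => NPB2 N.1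
  | 3 => NPB3 N.1
  | 4 => N.1
  | _ => ⊤

theorem mem_NPB3 {N : Subgroup (B 4)} {h : B 3} : h ∈ NPB3 N ↔ h ∈ PB 3 ∧
    (∀ k : Fin 2, (shift k 2 h : B 4) ∈ N) ∧ ∀ k : Fin 3, dbl k h ∈ N := by
  simp only [NPB3, Subgroup.mem_map, Subgroup.mem_inf, Subgroup.mem_comap, Fin.forall_fin_succ]
  constructor
  · rintro ⟨x, ⟨⟨⟨⟨h1, h2⟩, h3⟩, h4⟩, h5⟩, rfl⟩
    exact ⟨x.2, ⟨h1, h5, fun i => i.elim0⟩, h2, h3, h4, fun i => i.elim0⟩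
  · rintro ⟨h0, ⟨h1, h5, -⟩, h2, h3, h4, -⟩
    exact ⟨⟨h, h0⟩, ⟨⟨⟨⟨h1, h2⟩, h3⟩, h4⟩, h5⟩, rfl⟩

theorem mem_NPB2 {N : Subgroup (B 4)} {h : B 2} : h ∈ NPB2 N ↔ h ∈ PB 2 ∧
    (∀ k : Fin 2, (shift k 1 h : B 3) ∈ NPB3 N) ∧ ∀ k : Fin 2, dbl k h ∈ NPB3 N := by
  simp only [NPB2, Subgroup.mem_map, Subgroup.mem_inf, Subgroup.mem_comap, Fin.forall_fin_succ]
  constructor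
  · rintro ⟨x, ⟨⟨⟨h1, h2⟩, h3⟩, h4⟩, rfl⟩
    exact ⟨x.2, ⟨h1, h4, fun i => i.elim0⟩, h2, h3, fun i => i.elim0⟩
  · rintro ⟨h0, ⟨h1, h4, -⟩, h2, h3, -⟩
    exact ⟨⟨h, h0⟩, ⟨⟨⟨h1, h2⟩, h3⟩, h4⟩, rfl⟩

theorem dbl_conj {n : ℕ} (k : Fin n) (g : B n) {h : B n} (hh : h ∈ PB n) :
    dbl k (g * h * g⁻¹) =
      dbl ((rho n g)⁻¹ k) g * dbl ((rho n g)⁻¹ k) h * (dbl ((rho n g)⁻¹ k) g)⁻¹ := by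
  rw [dbl_mul, dbl_mul, dbl_inv, map_inv, mem_PB.1 hh, Perm.one_apply]

theorem NPB3_normal {N : Subgroup (B 4)} (hN : N.Normal) : (NPB3 N).Normal := by
  refine ⟨fun h hh g => ?_⟩
  rw [mem_NPB3] at hh ⊢
  refine ⟨(MonoidHom.normal_ker _).conj_mem _ hh.1 _, fun k => ?_, fun k => ?_⟩
  · rw [map_mul, map_mul, map_inv]; exact hN.conj_mem _ (hh.2.1 k) _
  · rw [dbl_conj _ _ hh.1]; exact hN.conj_mem _ (hh.2.2 _) _

theorem NPB2_normal {N : Subgroup (B 4)} (hN : N.Normal) : (NPB2 N).Normal := by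
  have hN' := NPB3_normal hN
  refine ⟨fun h hh g => ?_⟩
  rw [mem_NPB2] at hh ⊢
  refine ⟨(MonoidHom.normal_ker _).conj_mem _ hh.1 _, fun k => ?_, fun k => ?_⟩
  · rw [map_mul, map_mul, map_inv]; exact hN'.conj_mem _ (hh.2.1 k) _
  · rw [dbl_conj _ _ hh.1]; exact hN'.conj_mem _ (hh.2.2 _) _

instance NPB_normal (N : NFI) (n : ℕ) : (NPB N n).Normal := by
  match n with
  | 0 => exact Subgroup.normal_top
  | 1 => exact Subgroup.normal_top
  | 2 => exact NPB2_normal N.2.1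
  | 3 => exact NPB3_normal N.2.1
  | 4 => exact N.2.1
  | n + 5 => exact Subgroup.normal_top

theorem NPB_big (N : NFI) {n : ℕ} (h : 5 ≤ n) (g : B n) : g ∈ NPB N n := by
  obtain ⟨j, rfl⟩ := Nat.exists_eq_add_of_le' h
  exact Subgroup.mem_top g

theorem B_one_eq (g : B 1) : g = 1 := by
  induction g using B_induction with
  | h1 => rfl
  | hs i hi => omega
  | hm g h hg hh => simp [hg, hh]
  | hi g hg => simp [hg]

theorem dbl_mem {N : NFI} {n : ℕ} {g : B n} (hg : g ∈ NPB N n) (k : Fin n) :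
    dbl k g ∈ NPB N (n + 1) := by
  match n with
  | 0 => exact k.elim0
  | 1 => rw [B_one_eq g, dbl_one]; exact one_mem _
  | 2 => exact (mem_NPB2.1 hg).2.2 k
  | 3 => exact (mem_NPB3.1 hg).2.2 k
  | n + 4 => exact NPB_big N (by omega) _

theorem cable_mem {N : NFI} {n : ℕ} {g : B n} (hg : g ∈ NPB N n) (k : Fin n) (m : ℕ) :
    cable k m g ∈ NPB N (n + m) := by
  induction m with
  | zero => exact hg
  | succ m ih => exact dbl_mem ih _

theorem shift_sig {n m i : ℕ} (k : Fin n) (h : i + 1 < m + 1) :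
    shift k m (sig (m + 1) i) = sig (n + m) (k.val + i) := liftB_sig _ _ _ _ h

theorem hom_ext_B {G : Type*} [Group G] {n : ℕ} (φ ψ : B n →* G)
    (h : ∀ i, i + 1 < n → φ (sig n i) = ψ (sig n i)) : φ = ψ := by
  refine MonoidHom.ext fun g => ?_
  induction g using B_induction with
  | h1 => simp
  | hs i hi => exact h i hi
  | hm g h hg hh => simp [hg, hh]
  | hi g hg => simp [hg]

theorem shift_shift (k : Fin 3) (j l : Fin 2) (h : k.val = j.val + l.val) (g : B 2) :
    (shift k 1 g : B 4) = (shift j 2 (shift l 1 g : B 3) : B 4) := by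
  have : (shift k 1 : B 2 →* B 4) = (shift j 2 : B 3 →* B 4).comp (shift l 1 : B 2 →* B 3) := by
    refine hom_ext_B _ _ fun i hi => ?_
    have e1 : (shift l 1 (sig 2 i) : B 3) = sig 3 (l.val + i) := shift_sig l hi
    have e2 : (shift j 2 (sig 3 (l.val + i)) : B 4) = sig 4 (j.val + (l.val + i)) :=
      shift_sig j (by omega)
    have e3 : (shift k 1 (sig 2 i) : B 4) = sig 4 (k.val + i) := shift_sig k hi
    rw [MonoidHom.comp_apply, e1, e2, e3, h, add_assoc]
  rw [this]; rfl

theorem shift_triv {m p : ℕ} (e : 1 + m = p) (h : m + 1 = p) (k : Fin 1) (g : B (m + 1)) :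
    e ▸ shift k m g = h ▸ g := by
  subst e
  have h2 : ∀ q (h : m + 1 = q), ∃ φ : B (m + 1) →* B q, (∀ g, φ g = h ▸ g) ∧
      ∀ i, φ (sig (m + 1) i) = sig q i := by
    rintro _ rfl
    exact ⟨MonoidHom.id _, fun _ => rfl, fun _ => rfl⟩
  obtain ⟨φ, hφ, hs⟩ := h2 _ h
  rw [← hφ]
  have : shift k m = φ := by
    refine hom_ext_B _ _ fun i hi => ?_
    rw [hs, shift_sig k hi]
    congr 1
    omega
  rw [this]

theorem mem_cast {N : NFI} {n p : ℕ} (h : n = p) (g : B n) :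
    h ▸ g ∈ NPB N p ↔ g ∈ NPB N n := by subst h; rfl

theorem shift_mem {N : NFI} {n m : ℕ} {g : B (m + 1)} (hg : g ∈ NPB N (m + 1)) (k : Fin n) :
    shift k m g ∈ NPB N (n + m) := by
  by_cases hnm : 5 ≤ n + m
  · exact NPB_big N hnm _
  have hk := k.2
  have e1 : n = 1 ∨ m = 0 ∨ (n = 2 ∧ m = 1) ∨ (n = 2 ∧ m = 2) ∨ (n = 3 ∧ m = 1) := by omega
  rcases e1 with rfl | rfl | ⟨rfl, rfl⟩ | ⟨rfl, rfl⟩ | ⟨rfl, rfl⟩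
  · rw [← mem_cast (p := m + 1) (by omega), shift_triv (p := m + 1) (by omega) rfl]
    exact hg
  · rw [B_one_eq g, map_one]; exact one_mem _
  · exact (mem_NPB2.1 hg).2.1 k
  · exact (mem_NPB3.1 hg).2.1 k
  · have h1 := (mem_NPB2.1 hg).2.1
    have h2 : ∀ j l : Fin 2, (shift j 2 (shift l 1 g : B 3) : B 4) ∈ N.1 :=
      fun j l => (mem_NPB3.1 (h1 l)).2.1 j
    fin_cases k
    · have := h2 0 0
      rwa [← shift_shift 0 0 0 rfl g] at this
    · have := h2 0 1
      rwa [← shift_shift 1 0 1 rfl g] at this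
    · have := h2 1 1
      rwa [← shift_shift 2 1 1 rfl g] at this

/-- The equivalence relation `∼_N` on the morphisms between two objects of `PaB(n)`, `n ≤ 4`. -/
def sim (N : NFI) {n : ℕ} (τ₁ τ₂ : Ob n) : Setoid (Hom τ₁ τ₂) where
  r γ η := γ.1⁻¹ * η.1 ∈ NPB N n
  iseqv :=
    { refl := fun γ => by simp
      symm := fun {γ η} h => by simpa using inv_mem h
      trans := fun {γ η θ} h h' => by simpa [mul_assoc] using mul_mem h h' }

/-- The morphisms of the quotient groupoid `PaB(n)/∼_N`, `n ≤ 4`. -/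
def QHom (N : NFI) {n : ℕ} (τ₁ τ₂ : Ob n) : Type := Quotient (sim N τ₁ τ₂)

/-- The class in `PaB(n)/∼_N` of a morphism of `PaB(n)`. -/
def QHom.mk (N : NFI) {n : ℕ} {τ₁ τ₂ : Ob n} (γ : Hom τ₁ τ₂) : QHom N τ₁ τ₂ :=
  Quotient.mk (sim N τ₁ τ₂) γ

/-- Composition in `PaB(n)/∼_N`. -/
def QHom.comp {N : NFI} {n : ℕ} {τ₁ τ₂ τ₃ : Ob n} :
    QHom N τ₂ τ₃ → QHom N τ₁ τ₂ → QHom N τ₁ τ₃ :=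
  Quotient.map₂ (sa := sim N τ₂ τ₃) (sb := sim N τ₁ τ₂) (sc := sim N τ₁ τ₃) Hom.comp (by
    intro γ γ' h η η' h'
    change (γ.1 * η.1)⁻¹ * (γ'.1 * η'.1) ∈ NPB N n
    have := mul_mem ((NPB_normal N n).conj_mem _ h η.1⁻¹) h'
    simpa [mul_assoc] using this)

/-- The action of the symmetric group on `PaB(n)/∼_N`. -/
def QHom.act {N : NFI} {n : ℕ} {τ₁ τ₂ : Ob n} (θ : Perm (Fin n)) :
    QHom N τ₁ τ₂ → QHom N (τ₁.act θ) (τ₂.act θ) :=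
  Quotient.map (sa := sim N τ₁ τ₂) (sb := sim N (τ₁.act θ) (τ₂.act θ)) (Hom.act θ)
    (fun _ _ h => h)

/-- The elementary insertion `∘_i` on the truncated operad `PaB^{≤4}/∼_N`. -/
def QHom.ins {N : NFI} {n m : ℕ} {τ₁ τ₂ : Ob n} {σ₁ σ₂ : Ob (m + 1)} (γ : QHom N τ₁ τ₂)
    (i : Fin n) (η : QHom N σ₁ σ₂) : QHom N (τ₁.ins i σ₁) (τ₂.ins i σ₂) :=
  Quotient.map₂ (sa := sim N τ₁ τ₂) (sb := sim N σ₁ σ₂)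
    (sc := sim N (τ₁.ins i σ₁) (τ₂.ins i σ₂)) (fun γ η => γ.ins i η) (by
      intro γ γ' h η η' h'
      change (insBraid _ γ.1 η.1)⁻¹ * insBraid _ γ'.1 η'.1 ∈ NPB N (n + m)
      set k := τ₁.label⁻¹ i
      have e1 : γ'.1 = γ.1 * (γ.1⁻¹ * γ'.1) := by group
      have e2 : rho n (γ.1⁻¹ * γ'.1) = 1 := by rw [map_mul, map_inv, γ.2, γ'.2]; group
      have e3 : cable k m γ'.1 = cable k m γ.1 * cable k m (γ.1⁻¹ * γ'.1) := by
        conv_lhs => rw [e1, cable_mul, e2, Perm.one_apply]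
      have h1 := cable_mem (N := N) h k m
      have h2 := shift_mem (N := N) h' k
      have := mul_mem ((NPB_normal N _).conj_mem _ h1 (shift k m η.1)⁻¹) h2
      rw [map_mul, map_inv] at this
      simpa [insBraid, e3, mul_assoc] using this) γ η

/-- Morphisms `PaB^{≤4} → PaB^{≤4}/∼_N` of truncated operads in groupoids that are the identity on
objects. -/
structure Mor (N : NFI) where
  map : ∀ {n : ℕ}, n ≤ 4 → ∀ {τ₁ τ₂ : Ob n}, Hom τ₁ τ₂ → QHom N τ₁ τ₂
  map_id : ∀ {n : ℕ} (hn : n ≤ 4) (τ : Ob n), map hn (Hom.id τ) = QHom.mk N (Hom.id τ)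
  map_comp : ∀ {n : ℕ} (hn : n ≤ 4) {τ₁ τ₂ τ₃ : Ob n} (γ : Hom τ₂ τ₃) (η : Hom τ₁ τ₂),
    map hn (γ.comp η) = (map hn γ).comp (map hn η)
  map_act : ∀ {n : ℕ} (hn : n ≤ 4) {τ₁ τ₂ : Ob n} (θ : Perm (Fin n)) (γ : Hom τ₁ τ₂),
    map hn (γ.act θ) = (map hn γ).act θ
  map_ins : ∀ {n m : ℕ} (hn : n ≤ 4) (hm : m + 1 ≤ 4) (hnm : n + m ≤ 4) {τ₁ τ₂ : Ob n}
    {σ₁ σ₂ : Ob (m + 1)} (γ : Hom τ₁ τ₂) (i : Fin n) (η : Hom σ₁ σ₂),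
    map hnm (γ.ins i η) = (map hn γ).ins i (map hm η)

/-- The map `ou` from the automorphisms of an object of `PaB(n)/∼_N` to `PB_n/N_{PB_n}`. -/
def QHom.toPB {N : NFI} {n : ℕ} {τ : Ob n} :
    QHom N τ τ → PB n ⧸ (NPB N n).subgroupOf (PB n) :=
  Quotient.map (sa := sim N τ τ) (sb := QuotientGroup.leftRel _)
    (fun γ => (⟨γ.1, by rw [mem_PB, γ.2]; group⟩ : PB n))
    (fun γ η h => by
      exact QuotientGroup.leftRel_apply.2 (Subgroup.mem_subgroupOf.2 h))

/-- The homomorphism `T^{PB_n} : PB_n → PB_n/N_{PB_n}` induced by `T` on the automorphisms of an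
object of `PaB(n)`. -/
def Mor.onPB {N : NFI} (T : Mor N) {n : ℕ} (hn : n ≤ 4) (τ : Ob n) :
    PB n →* PB n ⧸ (NPB N n).subgroupOf (PB n) :=
  MonoidHom.mk' (fun h => (T.map hn (Hom.endo τ h)).toPB) (by
    intro g h
    have : Hom.endo τ (g * h) = (Hom.endo τ g).comp (Hom.endo τ h) := rfl
    rw [this, T.map_comp]
    generalize T.map hn (Hom.endo τ g) = a
    generalize T.map hn (Hom.endo τ h) = b
    induction a using Quotient.inductionOn with | _ a
    induction b using Quotient.inductionOn with | _ b
    rfl)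

/-- The object `12` of `PaB(2)`. -/
def ob12 : Ob 2 := ⟨.of 0 * .of 1, by decide⟩

/-- The object `21` of `PaB(2)`. -/
def ob21 : Ob 2 := ⟨.of 1 * .of 0, by decide⟩

/-- The object `(12)3` of `PaB(3)`. -/
def ob12_3 : Ob 3 := ⟨(.of 0 * .of 1) * .of 2, by decide⟩

/-- The object `1(23)` of `PaB(3)`. -/
def ob1_23 : Ob 3 := ⟨.of 0 * (.of 1 * .of 2), by decide⟩

/-- The object `((12)3)4` of `PaB(4)`. -/
def ob12_3_4 : Ob 4 := ⟨((.of 0 * .of 1) * .of 2) * .of 3, by decide⟩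

/-- The braiding `β : 12 → 21`. -/
def braiding : Hom ob12 ob21 := ⟨sig 2 0, by
  rw [rho_sig (by omega)]; decide⟩

/-- The associator `α : (12)3 → 1(23)`. -/
def associator : Hom ob12_3 ob1_23 := ⟨1, by rw [map_one]; decide⟩

/-- A pair `(m, f) ∈ ℤ × PB₃` that represents a `GT`-pair with the target `N`, i.e. that satisfies
the two hexagon relations and the pentagon relation modulo `N`. Whether `(m, f)` does so depends
only on `m` modulo `N_ord` and on the coset `f N_{PB₃}`. -/
structure GTPair (N : NFI) where
  m : ℤ
  f : PB 3
  hexagon : ((sig 3 0 * (sigSq 3 0 : B 3) ^ m * (f : B 3)⁻¹ * sig 3 1 * (sigSq 3 1 : B 3) ^ m * f :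
      B 3) : B 3 ⧸ NPB N 3) =
    (((f : B 3)⁻¹ * sig 3 0 * sig 3 1 * (sig 3 1 * sig 3 0 ^ 2 * (sig 3 1)⁻¹ * sigSq 3 1) ^ m :
      B 3) : B 3 ⧸ NPB N 3)
  hexagon' : (((f : B 3)⁻¹ * sig 3 1 * (sigSq 3 1 : B 3) ^ m * f * sig 3 0 *
      (sigSq 3 0 : B 3) ^ m : B 3) : B 3 ⧸ NPB N 3) =
    ((sig 3 1 * sig 3 0 * (sigSq 3 0 * (sig 3 1 * sig 3 0 ^ 2 * (sig 3 1)⁻¹)) ^ m * f : B 3) :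
      B 3 ⧸ NPB N 3)
  pentagon : ((phi_234 f * phi_1_23_4 f * phi_123 f : B 4) : B 4 ⧸ NPB N 4) =
    ((phi_1_2_34 f * phi_12_3_4 f : B 4) : B 4 ⧸ NPB N 4)

/-- (A representative of) a `GT`-shadow with the target `N`: a `GT`-pair represented by `(m, f)`
together with the corresponding morphism `T = T_{m,f}` of truncated operads, which is determined by
`T(α) = [α · m(f)]` and `T(β) = [β · m(x₁₂^m)]`, such that the induced homomorphisms
`PB_n → PB_n/N_{PB_n}` are onto for `n = 2, 3, 4`. -/
structure GTShadow (N : NFI) extends GTPair N where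
  T : Mor N
  map_associator : T.map (by decide) associator = QHom.mk N (associator.comp (Hom.endo ob12_3 f))
  map_braiding : T.map (by decide) braiding =
    QHom.mk N (braiding.comp (Hom.endo ob12 (sigSq 2 0 ^ m)))
  onto₂ : Function.Surjective (T.onPB (by decide) ob12)
  onto₃ : Function.Surjective (T.onPB (by decide) ob12_3)
  onto₄ : Function.Surjective (T.onPB (by decide) ob12_3_4)

/-- The source of a `GT`-shadow: the kernel of `T^{PB₄}`, as a subgroup of `B₄`. -/
def GTShadow.source {N : NFI} (s : GTShadow N) : Subgroup (B 4) :=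
  (s.T.onPB (by decide) ob12_3_4).ker.map (PB 4).subtype

/-- The free subgroup `F₂` of `PB₃` generated by `x₁₂` and `x₂₃`. -/
def F2 : Subgroup (PB 3) := Subgroup.closure {sigSq 3 0, sigSq 3 1}

/-- A `GT`-shadow is charming if the coset `f N_{PB₃}` meets `[F₂, F₂]` and if
`T^{F₂} : F₂ → F₂/(N_{PB₃} ∩ F₂)` is onto. -/
structure GTShadow.Charming {N : NFI} (s : GTShadow N) : Prop where
  comm : ∃ f₁ ∈ ⁅F2, F2⁆,
    (f₁ : PB 3 ⧸ (NPB N 3).subgroupOf (PB 3)) = (s.f : PB 3 ⧸ (NPB N 3).subgroupOf (PB 3))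
  onto : ∀ h ∈ F2, ∃ g ∈ F2,
    s.T.onPB (by decide) ob12_3 g = (h : PB 3 ⧸ (NPB N 3).subgroupOf (PB 3))

/-- The set `Hom(M, N)` of morphisms from `M` to `N` in the groupoid `GTSh♥` of charming
`GT`-shadows. -/
def CharmingHom (M N : NFI) : Type := {s : GTShadow N // s.Charming ∧ s.source = M.1}

/-- `M` and `N` lie in the same connected component of `GTSh♥`. -/
def Connected (M N : NFI) : Prop := Relation.EqvGen (fun M N => Nonempty (CharmingHom M N)) M N

/-- The intersection `N^♯` of all objects in the connected component of `N` in `GTSh♥`. -/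
def sharp (N : NFI) : Subgroup (B 4) := ⨅ K ∈ {K : NFI | Connected K N}, K.1

/-- `N` is isolated if every charming `GT`-shadow with the target `N` is settled, i.e. has the
source `N`. -/
def Isolated (N : NFI) : Prop := ∀ s : GTShadow N, s.Charming → s.source = N.1

end GTShadows

namespace GTShadows

open Equiv

/-! The argument rests on two facts about a shadow with target `N`.

Its source is again a normal subgroup of `B 4` of the same index as `N`. Surjectivity of `T` on `PB
4` identifies `PB 4` modulo the source with `PB 4` modulo `N`, which gives the index
(`GTShadow.index_source`); compatibility of `T` with the symmetric group actions gives normality in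
the whole braid group (`Mor.normal_map_ker_onPB`). Hence the index is constant on connected
components. Since `B 4` is finitely generated, it has only finitely many normal subgroups of a given
finite index, so each component is finite and the intersection `sharp N` has finite index
(`sharp_NFI`).

A charming shadow with target `M` also pushes forward to a charming shadow with any larger target
`K` (`GTShadow.proj`, `GTShadow.Charming.proj`). For a charming shadow with target `sharp N`, push
it forward to every `K` in the component. The source of each pushforward lies in the component too,
so it contains `sharp N`. Thus `T` sends an element of `sharp N` into every `K`, hence into their
intersection `sharp N`; in other words, `sharp N` lies in the source of the original shadow. Both
subgroups have the same finite index, so they coincide (`isolated_sharp`).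

Cofinality follows because `N` belongs to its own component, so `sharp N` is an isolated element
below it. -/

/-! ### Monotonicity of the subgroups `NPB N n`, and representatives of classes -/

theorem NPB3_mono {M N : Subgroup (B 4)} (h : M ≤ N) : NPB3 M ≤ NPB3 N := fun _ hg => by
  rw [mem_NPB3] at hg ⊢
  exact ⟨hg.1, fun k => h (hg.2.1 k), fun k => h (hg.2.2 k)⟩

theorem NPB2_mono {M N : Subgroup (B 4)} (h : M ≤ N) : NPB2 M ≤ NPB2 N := fun _ hg => by
  rw [mem_NPB2] at hg ⊢
  exact ⟨hg.1, fun k => NPB3_mono h (hg.2.1 k), fun k => NPB3_mono h (hg.2.2 k)⟩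

/-- In arities 2 and 3 membership is a list of membership conditions in the subgroup of `B 4`, so it
passes to a larger subgroup; outside arities 2 to 4 the subgroup is everything. This is what makes
all the projections from level `M` to level `N` well defined. -/
theorem NPB_mono {M N : NFI} (h : M ≤ N) (n : ℕ) : NPB M n ≤ NPB N n := by
  match n with
  | 0 => exact fun g _ => Subgroup.mem_top g
  | 1 => exact fun g _ => Subgroup.mem_top g
  | 2 => exact NPB2_mono h
  | 3 => exact NPB3_mono h
  | 4 => exact h
  | n + 5 => exact fun g _ => NPB_big N (by omega) g

theorem QHom.mk_eq_mk {N : NFI} {n : ℕ} {τ₁ τ₂ : Ob n} {γ η : Hom τ₁ τ₂} :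
    QHom.mk N γ = QHom.mk N η ↔ γ.1⁻¹ * η.1 ∈ NPB N n :=
  Quotient.eq (r := sim N τ₁ τ₂)

theorem QHom.exists_mk {N : NFI} {n : ℕ} {τ₁ τ₂ : Ob n} (q : QHom N τ₁ τ₂) :
    ∃ γ, QHom.mk N γ = q :=
  Quotient.exists_rep (s := sim N τ₁ τ₂) q

theorem QHom.toPB_mk_eq_one {N : NFI} {n : ℕ} {τ : Ob n} {γ : Hom τ τ} :
    (QHom.mk N γ).toPB = 1 ↔ γ.1 ∈ NPB N n :=
  (QuotientGroup.eq_one_iff _).trans Subgroup.mem_subgroupOf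

/-! ### Pushing shadows forward to a larger target -/

/-- The canonical projection `PaB(n)/∼_M → PaB(n)/∼_N` for `M ≤ N`. -/
def QHom.proj {M N : NFI} (h : M ≤ N) {n : ℕ} {τ₁ τ₂ : Ob n} : QHom M τ₁ τ₂ → QHom N τ₁ τ₂ :=
  Quotient.map (sa := sim M τ₁ τ₂) (sb := sim N τ₁ τ₂) id fun _ _ hr => NPB_mono h n hr

/-- The canonical projection `PB_n/M_{PB_n} → PB_n/N_{PB_n}` for `M ≤ N`. -/
def projPB {M N : NFI} (h : M ≤ N) (n : ℕ) :
    PB n ⧸ (NPB M n).subgroupOf (PB n) →* PB n ⧸ (NPB N n).subgroupOf (PB n) :=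
  QuotientGroup.map _ _ (MonoidHom.id _) fun _ hx => NPB_mono h n hx

theorem projPB_surjective {M N : NFI} (h : M ≤ N) (n : ℕ) :
    Function.Surjective (projPB h n) :=
  QuotientGroup.map_surjective_of_surjective _ _ _ (QuotientGroup.mk_surjective) _

theorem QHom.toPB_proj {M N : NFI} (h : M ≤ N) {n : ℕ} {τ : Ob n} (q : QHom M τ τ) :
    (QHom.proj h q).toPB = projPB h n q.toPB := by
  obtain ⟨γ, rfl⟩ := q.exists_mk
  rfl

/-- The composition of a morphism `PaB^{≤4} → PaB^{≤4}/∼_M` with the canonical projection onto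
`PaB^{≤4}/∼_N`, where `M ≤ N`. -/
def Mor.proj {M N : NFI} (h : M ≤ N) (T : Mor M) : Mor N where
  map hn _ _ γ := QHom.proj h (T.map hn γ)
  map_id hn τ := by rw [T.map_id]; rfl
  map_comp hn _ _ _ γ η := by
    rw [T.map_comp]
    -- The operations on both quotients are computed on representatives, and the projection leaves
    -- representatives unchanged; once representatives are chosen, both sides agree by definition.
    obtain ⟨a, ha⟩ := (T.map hn γ).exists_mk
    obtain ⟨b, hb⟩ := (T.map hn η).exists_mk
    rw [← ha, ← hb]
    rfl
  map_act hn _ _ θ γ := by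
    rw [T.map_act]
    obtain ⟨a, ha⟩ := (T.map hn γ).exists_mk
    rw [← ha]
    rfl
  map_ins hn hm hnm _ _ _ _ γ i η := by
    rw [T.map_ins hn hm hnm]
    obtain ⟨a, ha⟩ := (T.map hn γ).exists_mk
    obtain ⟨b, hb⟩ := (T.map hm η).exists_mk
    rw [← ha, ← hb]
    rfl

theorem Mor.onPB_proj {M N : NFI} (h : M ≤ N) (T : Mor M) {n : ℕ} (hn : n ≤ 4) (τ : Ob n)
    (g : PB n) : (T.proj h).onPB hn τ g = projPB h n (T.onPB hn τ g) :=
  QHom.toPB_proj h _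

theorem Mor.onPB_proj_surjective {M N : NFI} (h : M ≤ N) (T : Mor M) {n : ℕ} (hn : n ≤ 4)
    (τ : Ob n) (hT : Function.Surjective (T.onPB hn τ)) :
    Function.Surjective ((T.proj h).onPB hn τ) := fun y => by
  obtain ⟨x, rfl⟩ := projPB_surjective h n y
  obtain ⟨g, rfl⟩ := hT x
  exact ⟨g, Mor.onPB_proj h T hn τ g⟩

theorem mk_eq_mk_of_le {M N : NFI} (h : M ≤ N) {n : ℕ} {a b : B n}
    (hab : (a : B n ⧸ NPB M n) = b) : (a : B n ⧸ NPB N n) = b :=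
  QuotientGroup.eq.2 (NPB_mono h n (QuotientGroup.eq.1 hab))

/-- The `GT`-shadow with the target `N` that is induced by a `GT`-shadow with the target
`M ≤ N`. -/
def GTShadow.proj {M N : NFI} (h : M ≤ N) (s : GTShadow M) : GTShadow N where
  m := s.m
  f := s.f
  hexagon := mk_eq_mk_of_le h s.hexagon
  hexagon' := mk_eq_mk_of_le h s.hexagon'
  pentagon := mk_eq_mk_of_le h s.pentagon
  T := s.T.proj h
  map_associator := congrArg (QHom.proj h) s.map_associator
  map_braiding := congrArg (QHom.proj h) s.map_braiding
  onto₂ := s.T.onPB_proj_surjective h _ _ s.onto₂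
  onto₃ := s.T.onPB_proj_surjective h _ _ s.onto₃
  onto₄ := s.T.onPB_proj_surjective h _ _ s.onto₄

/-- The same witnesses serve at both levels: `f₁` and the preimages in `F2` found modulo `M` still
work modulo `N`. -/
theorem GTShadow.Charming.proj {M N : NFI} (h : M ≤ N) {s : GTShadow M} (hs : s.Charming) :
    (s.proj h).Charming where
  comm := by
    obtain ⟨f₁, hf₁, e⟩ := hs.comm
    exact ⟨f₁, hf₁, congrArg (projPB h 3) e⟩
  onto x hx := by
    obtain ⟨g, hg, e⟩ := hs.onto x hx
    exact ⟨g, hg, (s.T.onPB_proj h _ _ g).trans (congrArg (projPB h 3) e)⟩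

/-! ### The source of a shadow: normality and index -/

/-- Reduces the kernel to a test on an arbitrary representative of `T(g)`. A representative remains
one after projection to a larger target, so a single braid can be tested against many targets at
once. -/
theorem Mor.mem_ker_onPB {N : NFI} (T : Mor N) {n : ℕ} (hn : n ≤ 4) (τ : Ob n) {g : PB n}
    {γ : Hom τ τ} (hγ : QHom.mk N γ = T.map hn (Hom.endo τ g)) :
    g ∈ (T.onPB hn τ).ker ↔ γ.1 ∈ NPB N n := by
  rw [MonoidHom.mem_ker, ← QHom.toPB_mk_eq_one, hγ]
  rfl

/-- The kernel is clearly normal in `PB n`; the issue is conjugation by a braid `g` that is not pure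
and so is not an automorphism of `τ`. Such a `g` is a morphism from `τ` to a relabeled copy of `τ`,
and equivariance of `T` compares the automorphisms of the two objects without changing the
underlying braids. -/
theorem Mor.normal_map_ker_onPB {N : NFI} (T : Mor N) {n : ℕ} (hn : n ≤ 4) (τ : Ob n) :
    ((T.onPB hn τ).ker.map (PB n).subtype).Normal := by
  refine ⟨?_⟩
  rintro _ ⟨x, hx, rfl⟩ g
  have hy : g * x.1 * g⁻¹ ∈ PB n := (MonoidHom.normal_ker _).conj_mem _ x.2 g
  refine ⟨⟨_, hy⟩, ?_, rfl⟩
  -- This is the relabeling forced by `rho n g = (τ.act θ).label⁻¹ * τ.label`, given that `(τ.act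
  -- θ).label = θ * τ.label`.
  set θ : Perm (Fin n) := τ.label * (rho n g)⁻¹ * τ.label⁻¹
  let γ : Hom τ (τ.act θ) := ⟨g, by rw [Ob.label_act]; simp only [θ]; group⟩
  -- Conjugation written as a commuting square in the groupoid, so that functoriality and
  -- equivariance of `T` apply to it.
  have e : γ.comp (Hom.endo τ x) = ((Hom.endo τ ⟨_, hy⟩).act θ).comp γ :=
    Subtype.ext (show g * x.1 = g * x.1 * g⁻¹ * g by group)
  obtain ⟨c, hc⟩ := (T.map hn γ).exists_mk
  obtain ⟨a, ha⟩ := (T.map hn (Hom.endo τ x)).exists_mk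
  obtain ⟨b, hb⟩ := (T.map hn (Hom.endo τ ⟨_, hy⟩)).exists_mk
  have e' := congrArg (T.map hn) e
  rw [T.map_comp, T.map_comp, T.map_act, ← hc, ← ha, ← hb] at e'
  have e'' : (c.1 * a.1)⁻¹ * (b.1 * c.1) ∈ NPB N n := QHom.mk_eq_mk.1 e'
  have ha' : a.1 ∈ NPB N n := (T.mem_ker_onPB hn τ ha).1 hx
  refine (T.mem_ker_onPB hn τ hb).2 ?_
  -- The square says that `c * a` and `b * c` agree modulo the normal subgroup `NPB N n`. The
  -- product being conjugated is `c⁻¹ * b * c`, so conjugating it by `c` returns `b`.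
  have := (NPB_normal N n).conj_mem _ (mul_mem ha' e'') c.1
  simpa [mul_assoc] using this

instance finiteIndex_PB (n : ℕ) : (PB n).FiniteIndex := Subgroup.finiteIndex_ker _

theorem GTShadow.source_le {N : NFI} (s : GTShadow N) : s.source ≤ PB 4 :=
  Subgroup.map_subtype_le _

/-- By the first isomorphism theorem, `T` on `PB 4` being onto makes the relative indices in `PB 4`
of the source and of `N` equal; both are then multiplied by the index of `PB 4` in `B 4`. -/
theorem GTShadow.index_source {N : NFI} (s : GTShadow N) : s.source.index = N.1.index := by
  rw [← Subgroup.relIndex_mul_index s.source_le, ← Subgroup.relIndex_mul_index N.2.2.2]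
  congr 1
  rw [Subgroup.relIndex, Subgroup.relIndex, GTShadow.source, Subgroup.subgroupOf,
    Subgroup.comap_map_eq_self_of_injective (PB 4).subtype_injective, Subgroup.index_ker,
    MonoidHom.range_eq_top.2 s.onto₄, Subgroup.card_top]
  rfl

/-- Makes the source an object of the groupoid, so that a charming shadow is a morphism between two
elements of `NFI`. -/
theorem GTShadow.source_mem {N : NFI} (s : GTShadow N) :
    s.source.Normal ∧ s.source.FiniteIndex ∧ s.source ≤ PB 4 :=
  ⟨s.T.normal_map_ker_onPB _ _,
    ⟨by rw [s.index_source]; exact N.2.2.1.index_ne_zero⟩, s.source_le⟩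

/-- Since connectedness is a generated equivalence relation, an invariant need only be checked on
single morphisms; neither composition nor inversion of shadows is needed. -/
theorem Connected.index_eq {M N : NFI} (h : Connected M N) : M.1.index = N.1.index := by
  induction h with
  | rel M N h =>
    obtain ⟨s, -, hs⟩ := h
    rw [← hs, s.index_source]
  | refl => rfl
  | symm _ _ _ ih => exact ih.symm
  | trans _ _ _ _ _ ih ih' => exact ih.trans ih'

/-! ### Finitely many normal subgroups of a given index -/

theorem finite_B_hom (n : ℕ) (G : Type*) [Group G] [Finite G] : Finite (B n →* G) := by
  -- A homomorphism is determined by its values on the generators. The last index in `Fin n` is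
  -- superfluous: there `sig` takes its default value `1`, which does no harm to injectivity.
  refine Finite.of_injective (fun (φ : B n →* G) (i : Fin n) => φ (sig n i)) fun φ ψ h => ?_
  exact hom_ext_B φ ψ fun i hi => congrFun h ⟨i, by omega⟩

/-- A normal subgroup of index `d` is the kernel of the action on its cosets, hence of a
homomorphism to the symmetric group on `d` letters, and there are finitely many such homomorphisms.
-/
theorem finite_normal_of_index (n d : ℕ) (hd : d ≠ 0) :
    {K : Subgroup (B n) | K.Normal ∧ K.index = d}.Finite := by
  have := finite_B_hom n (Perm (Fin d))
  refine (Set.finite_range (MonoidHom.ker : (B n →* Perm (Fin d)) → _)).subset ?_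
  rintro K ⟨hK, rfl⟩
  have e : B n ⧸ K ≃ Fin K.index := Nat.equivFinOfCardPos hd
  refine ⟨e.permCongrHom.toMonoidHom.comp (MulAction.toPermHom (B n) (B n ⧸ K)), ?_⟩
  have hinj : Function.Injective e.permCongrHom.toMonoidHom := e.permCongrHom.injective
  ext x
  -- The kernel of the coset action is the normal core, which is `K` itself because `K` is normal.
  rw [MonoidHom.mem_ker, MonoidHom.comp_apply, map_eq_one_iff _ hinj, ← MonoidHom.mem_ker,
    ← Subgroup.normalCore_eq_ker, Subgroup.normalCore_eq_self]

/-! ### The intersection over a connected component -/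

theorem mem_sharp {N : NFI} {g : B 4} : g ∈ sharp N ↔ ∀ K, Connected K N → g ∈ K.1 := by
  simp only [sharp, Subgroup.mem_iInf, Set.mem_ofPred_eq]

theorem sharp_le {K N : NFI} (h : Connected K N) : sharp N ≤ K.1 := fun _ hg => mem_sharp.1 hg K h

theorem finite_connected (N : NFI) : {K : NFI | Connected K N}.Finite := by
  refine Set.Finite.of_finite_image ((finite_normal_of_index 4 _ N.2.2.1.index_ne_zero).subset ?_)
    Subtype.val_injective.injOn
  rintro _ ⟨K, hK, rfl⟩
  exact ⟨K.2.1, hK.index_eq⟩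

theorem sharp_NFI (N : NFI) :
    (sharp N).Normal ∧ (sharp N).FiniteIndex ∧ sharp N ≤ PB 4 := by
  refine ⟨⟨fun x hx g => ?_⟩, ?_, (sharp_le (Relation.EqvGen.refl N)).trans N.2.2.2⟩
  · rw [mem_sharp] at hx ⊢
    exact fun K hK => K.2.1.conj_mem _ (hx K hK) g
  · have := (finite_connected N).to_subtype
    have e : sharp N = ⨅ K : {K : NFI | Connected K N}, K.1.1 :=
      (iInf_subtype'' {K : NFI | Connected K N} fun K => K.1).symm
    rw [e]
    exact Subgroup.finiteIndex_iInf fun K => K.1.2.2.1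

theorem isolated_sharp (N : NFI) : Isolated ⟨sharp N, sharp_NFI N⟩ := by
  intro s hs
  have hle : sharp N ≤ s.source := by
    intro g hg
    have hgP : g ∈ PB 4 := (sharp_NFI N).2.2 hg
    refine ⟨⟨g, hgP⟩, ?_, rfl⟩
    -- One braid `γ` represents `T(g)` before any `K` is chosen, so showing that it lies in each `K`
    -- separately places it in the intersection.
    obtain ⟨γ, hγ⟩ := (s.T.map (n := 4) le_rfl (Hom.endo ob12_3_4 ⟨g, hgP⟩)).exists_mk
    refine (s.T.mem_ker_onPB _ _ hγ).2 (mem_sharp.2 fun K hK => ?_)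
    let sK : GTShadow K := s.proj (sharp_le hK)
    -- The pushforward to `K` is a morphism of the groupoid from its own source to `K`; so that
    -- source is in the component of `N` and contains `g`.
    have hc : Connected ⟨sK.source, sK.source_mem⟩ K :=
      Relation.EqvGen.rel _ _ ⟨⟨sK, hs.proj _, rfl⟩⟩
    obtain ⟨x, hx, rfl⟩ := sharp_le (hc.trans _ _ _ hK) hg
    exact (sK.T.mem_ker_onPB _ _ (congrArg (QHom.proj (sharp_le hK)) hγ)).1 hx
  refine le_antisymm ?_ hle
  -- The target here is `sharp N`, so the source has the same index as `sharp N`. Cancelling this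
  -- nonzero index leaves relative index 1, which is the reverse inclusion.
  have h1 := Subgroup.relIndex_mul_index hle
  rw [s.index_source] at h1
  exact Subgroup.relIndex_eq_one.1
    (Nat.eq_of_mul_eq_mul_right (Nat.pos_of_ne_zero (sharp_NFI N).2.1.index_ne_zero)
      (h1.trans (one_mul _).symm))

end GTShadows

theorem proposition3p3 :
    (∀ N : GTShadows.NFI,
      ∃ h : (GTShadows.sharp N).Normal ∧ (GTShadows.sharp N).FiniteIndex ∧
          GTShadows.sharp N ≤ GTShadows.PB 4,
        GTShadows.Isolated ⟨GTShadows.sharp N, h⟩) ∧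
    ∀ N : GTShadows.NFI, ∃ K : GTShadows.NFI, GTShadows.Isolated K ∧ K ≤ N :=
  ⟨fun N => ⟨GTShadows.sharp_NFI N, GTShadows.isolated_sharp N⟩, fun N =>
    ⟨⟨_, GTShadows.sharp_NFI N⟩, GTShadows.isolated_sharp N,
      GTShadows.sharp_le (Relation.EqvGen.refl N)⟩⟩
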